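/- Let $D\ge 1$, $\mathbf o,\mathbf q\in\mathbb R^D$, $dis=\|\mathbf o-\mathbf q\|$ (Euclidean norm), let $r\in\mathbb R$ be a distance threshold and $\epsilon_0\ge 0$. The distance comparison operation (DCO) asks whether $dis\le r$ and, if so, for the value $dis$. Let $P$ be a random orthogonal matrix, i.e. a random matrix distributed according to the normalized Haar measure on the orthogonal group $O(D)$, and let $\mathbf o'=P\mathbf o$, $\mathbf q'=P\mathbf q$, $\mathbf y=\mathbf o'-\mathbf q'$. ADSampling with parameter $\epsilon_0$ starts with $d=0$. While $d<D$ it increases $d$ by at least one, to a value at most $D$, according to an arbitrary fixed sampling schedule, computes $dis'=\sqrt{D/d}\,\bigl(\sum_{i=1}^{d}y_i^2\bigr)^{1/2}$, and rejects the hypothesis $dis\le r$ if $dis'>(1+\epsilon_0/\sqrt d)\,r$. If the hypothesis is rejected and $d<D$, it returns $0$ (the answer "$dis>r$"); if it is not rejected and $d<D$, it continues with the next iteration; if $d=D$, it returns $1$ (the answer "$dis\le r$") together with the distance $dis'$ if $dis'\le r$, and $0$ otherwise. A failure is the event that the returned result is not the correct result of the DCO (the answer $0$ if $dis>r$; the answer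 $1$ together with $dis$ if $dis\le r$). Then there is an absolute constant $c_0>0$ (independent of $D,\mathbf o,\mathbf q,r,\epsilon_0$ and the sampling schedule) such that always $$\mathbb P\{\text{failure}\}=0\quad\text{if } dis>r,\qquad \mathbb P\{\text{failure}\}\le\exp\left(-c_0\epsilon_0^2+\log D\right)\quad\text{if } dis\le r.$$ -/

import Mathlib

open MeasureTheory ProbabilityTheory

noncomputable section

namespace ADSampling

/-- The Borel sigma-algebra on the orthogonal group `O(D)`. -/
instance instMeasurableSpaceO (D : ℕ) : MeasurableSpace (Matrix.orthogonalGroup (Fin D) ℝ) :=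
  borel _

instance instBorelSpaceO (D : ℕ) : BorelSpace (Matrix.orthogonalGroup (Fin D) ℝ) := ⟨rfl⟩

instance instCompactSpaceO (D : ℕ) : CompactSpace (Matrix.orthogonalGroup (Fin D) ℝ) := by
  apply isCompact_iff_compactSpace.mp
  have hK : IsCompact (Set.univ.pi fun _ : Fin D => Set.univ.pi fun _ : Fin D =>
      Set.Icc (-1 : ℝ) 1) :=
    isCompact_univ_pi fun _ => isCompact_univ_pi fun _ => isCompact_Icc
  refine IsCompact.of_isClosed_subset (X := Matrix (Fin D) (Fin D) ℝ) hK ?_ ?_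
  · have h : ((Matrix.orthogonalGroup (Fin D) ℝ : Set (Matrix (Fin D) (Fin D) ℝ))) =
        {A | A * A.transpose = 1} := by
      ext A
      exact Matrix.mem_orthogonalGroup_iff (Fin D) ℝ
    rw [h]
    exact isClosed_eq (by fun_prop) continuous_const
  · intro A hA i _ j _
    have := entry_norm_bound_of_unitary hA i j
    rw [Real.norm_eq_abs, abs_le] at this
    exact this

/-- The uniform distribution on the orthogonal group `O(D)`: its Haar measure, normalized to have
total mass one. It is the law of a random orthogonal matrix. -/
def haarOrthogonal (D : ℕ) : Measure (Matrix.orthogonalGroup (Fin D) ℝ) :=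
  Measure.haarMeasure ⊤

/-- The transformed vector `A x`. -/
def transform {D : ℕ} (A : Matrix.orthogonalGroup (Fin D) ℝ) (x : EuclideanSpace ℝ (Fin D)) :
    EuclideanSpace ℝ (Fin D) :=
  WithLp.toLp 2 ((A : Matrix (Fin D) (Fin D) ℝ).mulVec x.ofLp)

/-- The approximate distance `dis' = √(D/d) ‖y|_{1,…,d}‖` computed from the first `d` coordinates
of `y`. -/
def approxDist {D : ℕ} (y : EuclideanSpace ℝ (Fin D)) (d : ℕ) : ℝ :=
  √((D : ℝ) / d) * √(∑ i : Fin D with i.val < d, y i ^ 2)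

/-- The hypothesis `H₀ : dis ≤ r` is rejected on the basis of the first `d` coordinates of `y`. -/
def Rejects {D : ℕ} (y : EuclideanSpace ℝ (Fin D)) (r ε₀ : ℝ) (d : ℕ) : Prop :=
  approxDist y d > (1 + ε₀ / √(d : ℝ)) * r

open Classical in
/-- The while-loop of ADSampling on the difference `y` of the transformed vectors, entered with `d`
sampled coordinates. An iteration samples `step d ≥ 1` further coordinates (or all remaining ones,
if there are fewer). The result `none` stands for the answer `0` ("`dis > r`"), the result `some t`
for the answer `1` ("`dis ≤ r`") together with the returned distance `t`. If `D ≥ 1`, a run started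
at `d = 0` returns inside the loop, so the value after it is never used. -/
def loop {D : ℕ} (y : EuclideanSpace ℝ (Fin D)) (r ε₀ : ℝ) (step : ℕ → ℕ+) (d : ℕ) : Option ℝ :=
  if d < D then
    let d' := min (d + (step d : ℕ)) D
    if Rejects y r ε₀ d' ∧ d' < D then none
    else if ¬ Rejects y r ε₀ d' ∧ d' < D then loop y r ε₀ step d'
    else if approxDist y d' ≤ r then some (approxDist y d') else none
  else none
termination_by D - d
decreasing_by
  have := (step d).pos
  omega

/-- ADSampling, run on the transformed data vector `o'`, the transformed query vector `q'` and the
threshold `r`, with parameter `ε₀` and sampling schedule `step`. -/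
def adSampling {D : ℕ} (ε₀ : ℝ) (step : ℕ → ℕ+) (o' q' : EuclideanSpace ℝ (Fin D)) (r : ℝ) :
    Option ℝ :=
  loop (o' - q') r ε₀ step 0

open Classical in
/-- The correct result of the distance comparison operation: whether `dis ≤ r` for the true distance
`dis` of `o` and `q`, together with `dis` if so. -/
def exactDCO {D : ℕ} (o q : EuclideanSpace ℝ (Fin D)) (r : ℝ) : Option ℝ :=
  if dist o q ≤ r then some (dist o q) else none

/-- ADSampling, run after the vectors were transformed by `A`, gives an incorrect result. -/
def Failure {D : ℕ} (ε₀ : ℝ) (step : ℕ → ℕ+) (A : Matrix.orthogonalGroup (Fin D) ℝ)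
    (o q : EuclideanSpace ℝ (Fin D)) (r : ℝ) : Prop :=
  adSampling ε₀ step (transform A o) (transform A q) r ≠ exactDCO o q r

end ADSampling

end

namespace ADSampling

/-! Put `x = o - q` and `y = P x`. At `d = D` the estimate equals `‖y‖ = dis`, so answer 1 is
impossible if `dis > r`, and otherwise a failure needs a rejection at some `0 < d < D`. As `‖y‖ ≤
r`, a rejection puts `y` in a cone where the first `d` coordinates carry more than `(1 + ε₀/√d)²
d/D` of `‖y‖²`. A union bound over `d` costs the term `log D`.

A cone sees only the direction of `P x`, which is uniform, so a Gaussian vector may replace it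
(`haarOrthogonal_mul_lintegral`). Comparing `exp(-‖g‖²)` on the cone with another diagonal Gaussian
(`haarOrthogonal_le_prod`) bounds each probability by `exp(-d u²/2)`, where `u = ε₀/√d`; hence `c₀ =
1/2`. -/

lemma transform_sub {D : ℕ} (A : Matrix.orthogonalGroup (Fin D) ℝ)
    (x y : EuclideanSpace ℝ (Fin D)) :
    transform A x - transform A y = transform A (x - y) := by
  simp [transform, Matrix.mulVec_sub]

lemma transform_smul {D : ℕ} (A : Matrix.orthogonalGroup (Fin D) ℝ)
    (c : ℝ) (x : EuclideanSpace ℝ (Fin D)) :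
    transform A (c • x) = c • transform A x := by
  simp [transform, Matrix.mulVec_smul]

lemma transform_mul {D : ℕ} (A B : Matrix.orthogonalGroup (Fin D) ℝ)
    (x : EuclideanSpace ℝ (Fin D)) :
    transform (A * B) x = transform A (transform B x) := by
  simp [transform, Matrix.mulVec_mulVec]

lemma norm_transform {D : ℕ} (A : Matrix.orthogonalGroup (Fin D) ℝ)
    (x : EuclideanSpace ℝ (Fin D)) : ‖transform A x‖ = ‖x‖ := by
  have hA := (Matrix.mem_orthogonalGroup_iff' (Fin D) ℝ).1 A.2
  have h (v : EuclideanSpace ℝ (Fin D)) : ‖v‖ ^ 2 = v.ofLp ⬝ᵥ v.ofLp := by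
    rw [EuclideanSpace.real_norm_sq_eq]
    simp [dotProduct, sq]
  refine (sq_eq_sq₀ (norm_nonneg _) (norm_nonneg _)).1 ?_
  rw [h, h, transform, Matrix.dotProduct_mulVec, Matrix.vecMul_mulVec, hA, Matrix.vecMul_one]

lemma transform_one {D : ℕ} (x : EuclideanSpace ℝ (Fin D)) : transform 1 x = x := by
  simp [transform]

/-- An element of the orthogonal group as a linear isometry of Euclidean space. -/
noncomputable def transformIsometry {D : ℕ} (A : Matrix.orthogonalGroup (Fin D) ℝ) :
    EuclideanSpace ℝ (Fin D) ≃ₗᵢ[ℝ] EuclideanSpace ℝ (Fin D) where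
  toFun := transform A
  invFun := transform A⁻¹
  map_add' x y := by simp [transform, Matrix.mulVec_add]
  map_smul' c x := transform_smul A c x
  left_inv x := by rw [← transform_mul, inv_mul_cancel, transform_one]
  right_inv x := by rw [← transform_mul, mul_inv_cancel, transform_one]
  norm_map' := norm_transform A

/-- The orthogonal group acts transitively on spheres. -/
lemma exists_transform_eq {D : ℕ} {x y : EuclideanSpace ℝ (Fin D)} (h : ‖x‖ = ‖y‖) :
    ∃ A : Matrix.orthogonalGroup (Fin D) ℝ, transform A x = y := by
  -- For vectors of equal norm, the reflection in the hyperplane orthogonal to `x - y` swaps them.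
  let f := (ℝ ∙ (x - y))ᗮ.reflection
  let b := EuclideanSpace.basisFun (Fin D) ℝ
  refine ⟨⟨_, f.toMatrix_mem_unitaryGroup b b⟩, ?_⟩
  have hf : f x = y := Submodule.reflection_sub h
  have := LinearMap.toMatrix_mulVec_repr b.toBasis b.toBasis
    (f.toLinearEquiv : EuclideanSpace ℝ (Fin D) →ₗ[ℝ] EuclideanSpace ℝ (Fin D)) x
  ext i
  have h2 := congrFun this i
  have hr : ⇑(b.toBasis.repr x) = x.ofLp := by
    ext j
    simp [b]
  rw [hr] at h2
  simpa [transform, b, hf] using h2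

/-! ### Deterministic analysis of the loop -/

lemma approxDist_full {D : ℕ} (hD : 1 ≤ D) (y : EuclideanSpace ℝ (Fin D)) :
    approxDist y D = ‖y‖ := by
  have : (D : ℝ) ≠ 0 := by positivity
  simp [approxDist, this, EuclideanSpace.norm_eq]

lemma loop_of_not_le {D : ℕ} (y : EuclideanSpace ℝ (Fin D)) (r ε₀ : ℝ) (step : ℕ → ℕ+)
    (h : ¬ ‖y‖ ≤ r) (d : ℕ) : loop y r ε₀ step d = none := by
  induction hn : D - d using Nat.strong_induction_on generalizing d with
  | _ n ih =>
    rw [loop]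
    by_cases hd : d < D
    · have hs := (step d).pos
      have hrec := ih _ (by omega) (min (d + (step d : ℕ)) D) rfl
      by_cases hlt : min (d + (step d : ℕ)) D < D
      · simp only [hd, hlt, hrec]
        split_ifs <;> simp_all
      · have hmin : min (d + (step d : ℕ)) D = D := by omega
        simp [hd, hmin, approxDist_full (by omega : 1 ≤ D), h]
    · simp [hd]

/-- `k = D` is not needed in `hr`: the last iteration compares the exact distance with `r`, whatever
the test says. -/
lemma loop_of_le {D : ℕ} (y : EuclideanSpace ℝ (Fin D)) (r ε₀ : ℝ) (step : ℕ → ℕ+)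
    (h : ‖y‖ ≤ r) (hr : ∀ k, 0 < k → k < D → ¬ Rejects y r ε₀ k) (d : ℕ) (hd : d < D) :
    loop y r ε₀ step d = some ‖y‖ := by
  induction hn : D - d using Nat.strong_induction_on generalizing d with
  | _ n ih =>
    rw [loop]
    have hs := (step d).pos
    by_cases hlt : min (d + (step d : ℕ)) D < D
    · have hrec := ih _ (by omega) (min (d + (step d : ℕ)) D) hlt rfl
      simp only [hd, hlt, hrec, hr _ (by omega) hlt]
      simp
    · have hmin : min (d + (step d : ℕ)) D = D := by omega
      simp [hd, hmin, approxDist_full (by omega : 1 ≤ D), h]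

lemma not_failure_of_lt_dist {D : ℕ} (ε₀ : ℝ) (step : ℕ → ℕ+)
    (A : Matrix.orthogonalGroup (Fin D) ℝ) (o q : EuclideanSpace ℝ (Fin D)) (r : ℝ)
    (h : dist o q > r) : ¬ Failure ε₀ step A o q r := by
  simp only [Failure, adSampling, exactDCO, not_not, not_le.2 h, if_false]
  apply loop_of_not_le
  rwa [transform_sub, norm_transform, ← dist_eq_norm, not_le]

lemma exists_rejects_of_failure {D : ℕ} (hD : 1 ≤ D) (ε₀ : ℝ) (step : ℕ → ℕ+)
    (A : Matrix.orthogonalGroup (Fin D) ℝ) (o q : EuclideanSpace ℝ (Fin D)) (r : ℝ)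
    (h : dist o q ≤ r) (hF : Failure ε₀ step A o q r) :
    ∃ d, 0 < d ∧ d < D ∧ Rejects (transform A (o - q)) r ε₀ d := by
  by_contra! hc
  apply hF
  have hn : ‖transform A (o - q)‖ = dist o q := by rw [norm_transform, dist_eq_norm]
  simp only [adSampling, exactDCO, h, if_true, transform_sub]
  rw [loop_of_le _ r ε₀ step (hn.trans_le h) hc 0 (by omega), hn]

/-- The vectors whose first `d` coordinates carry more than the fraction `s` of the squared norm. -/
def headCone (D d : ℕ) (s : ℝ) : Set (EuclideanSpace ℝ (Fin D)) :=
  {y | s * ∑ i, y i ^ 2 < ∑ i : Fin D with i.val < d, y i ^ 2}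

lemma measurableSet_headCone (D d : ℕ) (s : ℝ) : MeasurableSet (headCone D d s) :=
  measurableSet_lt (by fun_prop) (by fun_prop)

lemma smul_mem_headCone_iff {D d : ℕ} {s c : ℝ} (hc : c ≠ 0) (y : EuclideanSpace ℝ (Fin D)) :
    c • y ∈ headCone D d s ↔ y ∈ headCone D d s := by
  have : 0 < c ^ 2 := by positivity
  simp only [headCone, Set.mem_ofPred_eq, PiLp.smul_apply, smul_eq_mul, mul_pow, ← Finset.mul_sum]
  rw [mul_left_comm, mul_lt_mul_iff_right₀ this]

/-- Lowering `r` to `‖y‖` in the test makes it homogeneous in `y`; squaring gives the cone. -/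
lemma mem_headCone_of_rejects {D d : ℕ} {y : EuclideanSpace ℝ (Fin D)} {r ε₀ : ℝ} (hε : 0 ≤ ε₀)
    (hd : 0 < d) (hD : 0 < D) (hy : ‖y‖ ≤ r) (h : Rejects y r ε₀ d) :
    y ∈ headCone D d ((1 + ε₀ / √(d : ℝ)) ^ 2 * (d / D)) := by
  have hd' : (0 : ℝ) < d := by positivity
  have hD' : (0 : ℝ) < D := by positivity
  have h1 : (1 + ε₀ / √(d : ℝ)) * ‖y‖ < √((D : ℝ) / d) * √(∑ i : Fin D with i.val < d, y i ^ 2) :=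
    lt_of_le_of_lt (by gcongr) h
  have h2 := pow_lt_pow_left₀ h1 (by positivity) two_ne_zero
  rw [mul_pow, mul_pow, Real.sq_sqrt (by positivity), Real.sq_sqrt (by positivity),
    EuclideanSpace.real_norm_sq_eq] at h2
  have h3 := mul_lt_mul_of_pos_left h2 (show (0 : ℝ) < d / D by positivity)
  rw [← mul_assoc, ← mul_assoc, div_mul_div_cancel₀ hD'.ne', div_self hd'.ne', one_mul] at h3
  rw [headCone, Set.mem_ofPred_eq, mul_comm ((1 + ε₀ / √(d : ℝ)) ^ 2)]
  exact h3

/-! ### Haar measure and uniform directions -/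

instance isProbabilityMeasure_haarOrthogonal (D : ℕ) : IsProbabilityMeasure (haarOrthogonal D) :=
  ⟨Measure.haarMeasure_self⟩

instance isHaarMeasure_haarOrthogonal (D : ℕ) : (haarOrthogonal D).IsHaarMeasure :=
  inferInstanceAs (Measure.haarMeasure _).IsHaarMeasure

instance secondCountableTopology_orthogonalGroup (D : ℕ) :
    SecondCountableTopology (Matrix.orthogonalGroup (Fin D) ℝ) :=
  haveI : SecondCountableTopology (Matrix (Fin D) (Fin D) ℝ) :=
    inferInstanceAs (SecondCountableTopology (Fin D → Fin D → ℝ))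
  TopologicalSpace.Subtype.secondCountableTopology _

/-- A right translate is again a Haar probability measure, hence the same one by uniqueness.
Rotating the vector that `A` acts on multiplies `A` on the right. -/
instance isMulRightInvariant_haarOrthogonal (D : ℕ) : (haarOrthogonal D).IsMulRightInvariant where
  map_mul_right_eq_self g := by
    have : IsProbabilityMeasure ((haarOrthogonal D).map (· * g)) :=
      Measure.isProbabilityMeasure_map (by fun_prop)
    exact Measure.isHaarMeasure_eq_of_isProbabilityMeasure _ _

lemma measurable_transform (D : ℕ) :
    Measurable fun p : Matrix.orthogonalGroup (Fin D) ℝ × EuclideanSpace ℝ (Fin D) =>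
      transform p.1 p.2 := by
  apply Continuous.measurable
  unfold transform
  fun_prop

lemma haarOrthogonal_transform_congr {D : ℕ} {B : Set (EuclideanSpace ℝ (Fin D))}
    (hcone : ∀ c : ℝ, c ≠ 0 → ∀ y, c • y ∈ B ↔ y ∈ B)
    {x y : EuclideanSpace ℝ (Fin D)} (hx : x ≠ 0) (hy : y ≠ 0) :
    haarOrthogonal D {A | transform A x ∈ B} = haarOrthogonal D {A | transform A y ∈ B} := by
  have hc : ‖x‖ / ‖y‖ ≠ 0 := by simp [hx, hy]
  obtain ⟨R, hR⟩ := exists_transform_eq (x := (‖x‖ / ‖y‖) • y) (y := x) (by simp [norm_smul, hy])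
  have h : {A | transform A y ∈ B} = (· * R⁻¹) ⁻¹' {A | transform A x ∈ B} := by
    ext A
    rw [Set.mem_preimage, Set.mem_ofPred_eq, Set.mem_ofPred_eq, ← hR, ← transform_mul,
      inv_mul_cancel_right, transform_smul, hcone _ hc]
  rw [h, measure_preimage_mul_right]

/-- Mixing over the orthogonal group replaces a rotation invariant weight by the uniform direction:
the weight of a cone is the fraction of rotations that move a given vector into it. -/
lemma haarOrthogonal_mul_lintegral {D : ℕ} {B : Set (EuclideanSpace ℝ (Fin D))}
    (hB : MeasurableSet B) (hcone : ∀ c : ℝ, c ≠ 0 → ∀ y, c • y ∈ B ↔ y ∈ B)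
    {x : EuclideanSpace ℝ (Fin D)} (hx : x ≠ 0) {w : ℝ → ENNReal} (hw : Measurable w) :
    haarOrthogonal D {A | transform A x ∈ B} * ∫⁻ g : EuclideanSpace ℝ (Fin D), w ‖g‖ =
      ∫⁻ g in B, w ‖g‖ := by
  -- Makes the volume atomless, so that `g = 0` is negligible.
  have : Nontrivial (EuclideanSpace ℝ (Fin D)) := ⟨x, 0, hx⟩
  have hmeas : Measurable fun p : Matrix.orthogonalGroup (Fin D) ℝ × EuclideanSpace ℝ (Fin D) =>
      B.indicator (fun g => w ‖g‖) (transform p.1 p.2) :=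
    ((hw.comp measurable_norm).indicator hB).comp (measurable_transform D)
  -- Tonelli for `w ‖g‖` on the pairs with `A g ∈ B`: the integral over `A` does not depend on the
  -- direction of `g`, and each `A` preserves volume and norm.
  calc _ = ∫⁻ g : EuclideanSpace ℝ (Fin D), ∫⁻ A, B.indicator (fun g => w ‖g‖) (transform A g)
        ∂haarOrthogonal D := by
        rw [← lintegral_const_mul _ (by fun_prop)]
        refine lintegral_congr_ae ?_
        filter_upwards [Measure.ae_ne volume (0 : EuclideanSpace ℝ (Fin D))] with g hg
        have hset : MeasurableSet {A : Matrix.orthogonalGroup (Fin D) ℝ | transform A g ∈ B} :=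
          (measurable_transform D).comp measurable_prodMk_right hB
        rw [haarOrthogonal_transform_congr hcone hx hg, mul_comm, ← lintegral_indicator_const hset]
        refine lintegral_congr fun A => ?_
        by_cases hA : transform A g ∈ B <;> simp [hA, norm_transform]
    _ = ∫⁻ A, (∫⁻ g : EuclideanSpace ℝ (Fin D), B.indicator (fun g => w ‖g‖) (transform A g))
        ∂haarOrthogonal D := by
        rw [lintegral_lintegral_swap]
        exact (hmeas.comp measurable_swap).aemeasurable
    _ = ∫⁻ _A, (∫⁻ g in B, w ‖g‖) ∂haarOrthogonal D := by
        refine lintegral_congr fun A => ?_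
        rw [← lintegral_indicator hB]
        exact (transformIsometry A).measurePreserving.lintegral_comp
          ((hw.comp measurable_norm).indicator hB)
    _ = _ := by rw [lintegral_const, measure_univ, mul_one]

/-! ### Gaussian integrals and the Chernoff bound -/

lemma integrable_exp_neg_sum {ι : Type*} [Fintype ι] {a : ι → ℝ} (ha : ∀ i, 0 < a i) :
    Integrable fun g : EuclideanSpace ℝ ι => Real.exp (-∑ i, a i * g i ^ 2) := by
  rw [← (PiLp.volume_preserving_toLp ι).integrable_comp_emb
    (MeasurableEquiv.toLp 2 _).measurableEmbedding]
  simp only [Function.comp_def, ← Finset.sum_neg_distrib, Real.exp_sum, ← neg_mul]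
  exact Integrable.fintype_prod (f := fun i (v : ℝ) => Real.exp (-a i * v ^ 2))
    fun i => integrable_exp_neg_mul_sq (ha i)

lemma integral_exp_neg_sum {ι : Type*} [Fintype ι] (a : ι → ℝ) :
    ∫ g : EuclideanSpace ℝ ι, Real.exp (-∑ i, a i * g i ^ 2) = ∏ i, √(Real.pi / a i) := by
  rw [← (PiLp.volume_preserving_toLp ι).integral_comp
    (MeasurableEquiv.toLp 2 _).measurableEmbedding]
  simp only [← Finset.sum_neg_distrib, Real.exp_sum, ← neg_mul]
  rw [integral_fintype_prod_volume_eq_prod (f := fun i (v : ℝ) => Real.exp (-a i * v ^ 2))]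
  simp only [integral_gaussian]

lemma lintegral_exp_neg_sum {ι : Type*} [Fintype ι] {a : ι → ℝ} (ha : ∀ i, 0 < a i) :
    ∫⁻ g : EuclideanSpace ℝ ι, ENNReal.ofReal (Real.exp (-∑ i, a i * g i ^ 2)) =
      ENNReal.ofReal (∏ i, √(Real.pi / a i)) := by
  rw [← ofReal_integral_eq_lintegral_ofReal (integrable_exp_neg_sum ha)
    (.of_forall fun _ => (Real.exp_pos _).le), integral_exp_neg_sum]

/-- Chernoff bound for a random rotation, with Gaussian weights: if the quadratic form with
coefficients `1 - a i` is nonnegative on a cone, the probability to hit it is at most `∏ (a i)^(-1/2)`. -/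
lemma haarOrthogonal_le_prod {D : ℕ} {B : Set (EuclideanSpace ℝ (Fin D))}
    (hB : MeasurableSet B) (hcone : ∀ c : ℝ, c ≠ 0 → ∀ y, c • y ∈ B ↔ y ∈ B)
    {x : EuclideanSpace ℝ (Fin D)} (hx : x ≠ 0) {a : Fin D → ℝ} (ha : ∀ i, 0 < a i)
    (haB : ∀ y ∈ B, ∑ i, a i * y i ^ 2 ≤ ∑ i, y i ^ 2) :
    haarOrthogonal D {A | transform A x ∈ B} ≤ ENNReal.ofReal (∏ i, √(a i)⁻¹) := by
  have h := haarOrthogonal_mul_lintegral hB hcone hx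
    (w := fun t => ENNReal.ofReal (Real.exp (-t ^ 2))) (by fun_prop)
  simp only [EuclideanSpace.real_norm_sq_eq] at h
  have h1 := lintegral_exp_neg_sum (ι := Fin D) (a := fun _ => 1) (fun _ => one_pos)
  simp only [one_mul, div_one] at h1
  have hpos : 0 < ∏ _i : Fin D, √Real.pi := Finset.prod_pos fun _ _ => by positivity
  rw [h1] at h
  have h2 : ∏ i, √(Real.pi / a i) = (∏ i, √(a i)⁻¹) * ∏ _i : Fin D, √Real.pi := by
    rw [← Finset.prod_mul_distrib]
    refine Finset.prod_congr rfl fun i _ => ?_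
    rw [← Real.sqrt_mul (inv_nonneg.2 (ha i).le), div_eq_inv_mul]
  have h3 : haarOrthogonal D {A | transform A x ∈ B} * ENNReal.ofReal (∏ _i : Fin D, √Real.pi) ≤
      ENNReal.ofReal (∏ i, √(a i)⁻¹) * ENNReal.ofReal (∏ _i : Fin D, √Real.pi) := by
    rw [h, ← ENNReal.ofReal_mul (Finset.prod_nonneg fun _ _ => Real.sqrt_nonneg _), ← h2,
      ← lintegral_exp_neg_sum ha]
    -- On `B` the hypothesis `haB` compares the two Gaussian weights; then the domain grows to the
    -- whole space.
    refine (setLIntegral_mono' hB fun y hy => ?_).trans (setLIntegral_le_lintegral _ _)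
    have := haB y hy
    gcongr
  exact (ENNReal.mul_le_mul_iff_left (ENNReal.ofReal_pos.2 hpos).ne' ENNReal.ofReal_ne_top).1 h3

lemma headCone_eq_empty {D d : ℕ} {s : ℝ} (hs : 1 ≤ s) : headCone D d s = ∅ := by
  refine Set.eq_empty_of_forall_notMem fun y hy => ?_
  rw [headCone, Set.mem_ofPred_eq] at hy
  have h1 : ∑ i : Fin D with i.val < d, y i ^ 2 ≤ ∑ i, y i ^ 2 :=
    Finset.sum_le_sum_of_subset_of_nonneg (Finset.filter_subset _ _) fun _ _ _ => sq_nonneg _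
  have h2 : 0 ≤ ∑ i, y i ^ 2 := Finset.sum_nonneg fun _ _ => sq_nonneg _
  nlinarith

lemma card_filter_val_lt {D d : ℕ} (hd : d ≤ D) :
    (Finset.univ.filter fun i : Fin D => i.val < d).card = d := by
  simp [Fin.card_filter_val_lt, hd]

lemma card_filter_not_val_lt {D d : ℕ} (hd : d ≤ D) :
    (Finset.univ.filter fun i : Fin D => ¬ i.val < d).card = D - d := by
  have := Finset.card_filter_add_card_filter_not (s := Finset.univ) fun i : Fin D => i.val < d
  rw [card_filter_val_lt hd, Finset.card_univ, Fintype.card_fin] at this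
  omega

/-- Apply `1 + t ≤ exp t` to both factors; the terms linear in `u` cancel in the exponent. -/
lemma chernoff_rate_le {D d : ℕ} (hdD : d < D) {u : ℝ} (hu : 0 ≤ u) :
    (1 + u) ^ d * √((D - (1 + u) ^ 2 * d) / (D - d)) ^ (D - d) ≤ Real.exp (-(d * u ^ 2 / 2)) := by
  have hdD' : (0 : ℝ) < D - d := sub_pos.2 (by exact_mod_cast hdD)
  have h1 : (1 + u) ^ d ≤ Real.exp (d * u) := by
    rw [Real.exp_nat_mul]
    exact pow_le_pow_left₀ (by positivity) (by linarith [Real.add_one_le_exp u]) _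
  have h2 : √((D - (1 + u) ^ 2 * d) / (D - d)) ≤
      Real.exp (-((2 * u + u ^ 2) * d) / (D - d) / 2) := by
    refine Real.sqrt_le_iff.2 ⟨(Real.exp_pos _).le, ?_⟩
    rw [← Real.exp_nat_mul]
    have h := Real.add_one_le_exp (-((2 * u + u ^ 2) * d) / (D - d : ℝ))
    convert h using 1
    · field_simp
      ring
    · push_cast
      ring_nf
  calc _ ≤ Real.exp (d * u) * Real.exp (-((2 * u + u ^ 2) * d) / (D - d) / 2) ^ (D - d) := by
        gcongr
    _ = _ := by
        rw [← Real.exp_nat_mul, ← Real.exp_add, Nat.cast_sub hdD.le]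
        congr 1
        field_simp
        ring

lemma haarOrthogonal_headCone_le {D d : ℕ} (hd : 0 < d) (hdD : d < D)
    {x : EuclideanSpace ℝ (Fin D)} (hx : x ≠ 0) {u : ℝ} (hu : 0 ≤ u) :
    haarOrthogonal D {A | transform A x ∈ headCone D d ((1 + u) ^ 2 * (d / D))} ≤
      ENNReal.ofReal (Real.exp (-(d * u ^ 2 / 2))) := by
  have hd0 : (0 : ℝ) < d := by positivity
  have hdD' : (0 : ℝ) < D - d := sub_pos.2 (by exact_mod_cast hdD)
  have hD0 : (0 : ℝ) < D := by linarith
  have hβ : 1 ≤ (1 + u) ^ 2 := one_le_pow₀ (by linarith)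
  -- A required share of at least 1 is impossible, and the tail weight below would not be positive.
  by_cases hlt : (D : ℝ) ≤ (1 + u) ^ 2 * d
  · rw [headCone_eq_empty]
    · simp
    · rwa [← mul_div_assoc, one_le_div hD0]
  push Not at hlt
  have hpos : 0 < D - (1 + u) ^ 2 * d := sub_pos.2 hlt
  -- The Gaussian with these weights has mean energy share exactly `(1 + u)² d/D` on the head, and
  -- the two quadratic forms agree on the boundary of the cone.
  let a : Fin D → ℝ := fun i =>
    if i.val < d then ((1 + u) ^ 2)⁻¹ else (D - d) / (D - (1 + u) ^ 2 * d)
  have ha : ∀ i, 0 < a i := fun i => by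
    dsimp only [a]
    split_ifs <;> positivity
  refine (haarOrthogonal_le_prod (measurableSet_headCone _ _ _)
    (fun c hc y => smul_mem_headCone_iff hc y) hx ha fun y hy => ?_).trans
    (ENNReal.ofReal_le_ofReal ?_)
  · rw [headCone, Set.mem_ofPred_eq] at hy
    simp only [a, ite_mul, Finset.sum_ite, ← Finset.mul_sum]
    rw [← Finset.sum_filter_add_sum_filter_not Finset.univ (fun i : Fin D => i.val < d)
      (fun i => y i ^ 2)] at hy ⊢
    set S := ∑ i : Fin D with i.val < d, y i ^ 2
    set T := ∑ i : Fin D with ¬ i.val < d, y i ^ 2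
    have hy' : (1 + u) ^ 2 * d * (S + T) < D * S := by
      rw [← mul_div_assoc, div_mul_eq_mul_div, div_lt_iff₀ hD0] at hy
      linarith
    have key : S + T - (((1 + u) ^ 2)⁻¹ * S + (D - d) / (D - (1 + u) ^ 2 * d) * T) =
        ((1 + u) ^ 2 - 1) * (D * S - (1 + u) ^ 2 * d * (S + T)) /
          ((1 + u) ^ 2 * (D - (1 + u) ^ 2 * d)) := by
      field_simp
      ring
    have : 0 ≤ ((1 + u) ^ 2 - 1) * (D * S - (1 + u) ^ 2 * d * (S + T)) /
          ((1 + u) ^ 2 * (D - (1 + u) ^ 2 * d)) :=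
      div_nonneg (mul_nonneg (by linarith) (by linarith)) (by positivity)
    linarith
  · refine le_of_eq_of_le ?_ (chernoff_rate_le hdD hu)
    have h : ∀ i, √(a i)⁻¹ = if i.val < d then 1 + u else
        √((D - (1 + u) ^ 2 * d) / (D - d)) := fun i => by
      dsimp only [a]
      split_ifs
      · rw [inv_inv, Real.sqrt_sq (by linarith)]
      · rw [inv_div]
    simp only [h, Finset.prod_ite, Finset.prod_const, card_filter_val_lt hdD.le,
      card_filter_not_val_lt hdD.le]

lemma haarOrthogonal_exists_headCone_le {D : ℕ} (hD : 1 ≤ D) {x : EuclideanSpace ℝ (Fin D)}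
    (hx : x ≠ 0) {ε₀ : ℝ} (hε : 0 ≤ ε₀) :
    haarOrthogonal D (⋃ d ∈ Finset.Ioo 0 D,
        {A | transform A x ∈ headCone D d ((1 + ε₀ / √(d : ℝ)) ^ 2 * (d / D))}) ≤
      ENNReal.ofReal (Real.exp (-(1 / 2) * ε₀ ^ 2 + Real.log D)) := by
  have hD0 : (0 : ℝ) < D := by positivity
  calc _ ≤ ∑ d ∈ Finset.Ioo 0 D, haarOrthogonal D
        {A | transform A x ∈ headCone D d ((1 + ε₀ / √(d : ℝ)) ^ 2 * (d / D))} :=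
        measure_biUnion_finset_le _ _
    _ ≤ ∑ d ∈ Finset.Ioo 0 D, ENNReal.ofReal (Real.exp (-(1 / 2) * ε₀ ^ 2)) := by
        refine Finset.sum_le_sum fun d hd => ?_
        obtain ⟨hd0, hdD⟩ := Finset.mem_Ioo.1 hd
        have hd' : (0 : ℝ) < d := by positivity
        refine (haarOrthogonal_headCone_le hd0 hdD hx (by positivity)).trans_eq ?_
        -- With `u = ε₀/√d`, `d u² = ε₀²` for every `d`.
        rw [div_pow, Real.sq_sqrt hd'.le]
        congr 2
        field_simp
    _ ≤ D * ENNReal.ofReal (Real.exp (-(1 / 2) * ε₀ ^ 2)) := by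
        rw [Finset.sum_const, nsmul_eq_mul, Nat.card_Ioo]
        gcongr
        omega
    _ = _ := by
        rw [Real.exp_add, Real.exp_log hD0, mul_comm, ENNReal.ofReal_mul (Real.exp_pos _).le,
          ENNReal.ofReal_natCast]

end ADSampling

/-- There is an absolute constant `c₀ > 0` such that, for a random orthogonal matrix `P`, the failure
probability of ADSampling on a single distance comparison is `0` if `dis > r`, and at most
`exp (-c₀ ε₀² + log D)` if `dis ≤ r`. -/
theorem lemma3p2 :
    ∃ c₀ : ℝ, 0 < c₀ ∧
      ∀ (D : ℕ), 1 ≤ D → ∀ (ε₀ : ℝ), 0 ≤ ε₀ → ∀ (step : ℕ → ℕ+)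
        (o q : EuclideanSpace ℝ (Fin D)) (r : ℝ)
        (Ω : Type*) [MeasurableSpace Ω] (μ : Measure Ω) [IsProbabilityMeasure μ]
        (P : Ω → Matrix.orthogonalGroup (Fin D) ℝ),
        HasLaw P (ADSampling.haarOrthogonal D) μ →
          (dist o q > r → μ {ω | ADSampling.Failure ε₀ step (P ω) o q r} = 0) ∧
          (dist o q ≤ r → μ {ω | ADSampling.Failure ε₀ step (P ω) o q r} ≤
            ENNReal.ofReal (Real.exp (-c₀ * ε₀ ^ 2 + Real.log D))) := by
  refine ⟨1 / 2, by norm_num, fun D hD ε₀ hε step o q r Ω _ μ _ P hP => ⟨fun h => ?_, fun h => ?_⟩⟩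
  · simp [ADSampling.not_failure_of_lt_dist ε₀ step _ o q r h]
  -- The zero vector has no direction, but its estimates are 0 and never exceed the nonnegative
  -- threshold.
  by_cases hx : o - q = 0
  · have hempty : {ω | ADSampling.Failure ε₀ step (P ω) o q r} = ∅ := by
      refine Set.eq_empty_of_forall_notMem fun ω hω => ?_
      obtain ⟨d, -, -, hrej⟩ := ADSampling.exists_rejects_of_failure hD ε₀ step (P ω) o q r h hω
      have hr : 0 ≤ r := dist_nonneg.trans h
      refine absurd hrej (not_lt.2 ?_)
      have h0 : ADSampling.approxDist (ADSampling.transform (P ω) (o - q)) d = 0 := by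
        simp [hx, ADSampling.approxDist, ADSampling.transform]
      rw [h0]
      positivity
    simp [hempty]
  -- The law of `P` is applied to this measurable superset, so measurability of the failure event is
  -- not needed.
  have hmeas : MeasurableSet (⋃ d ∈ Finset.Ioo 0 D, {A : Matrix.orthogonalGroup (Fin D) ℝ |
      ADSampling.transform A (o - q) ∈
        ADSampling.headCone D d ((1 + ε₀ / √(d : ℝ)) ^ 2 * (d / D))}) :=
    Finset.measurableSet_biUnion _ fun d _ =>
      (ADSampling.measurable_transform D).comp measurable_prodMk_right
        (ADSampling.measurableSet_headCone _ _ _)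
  refine le_trans (measure_mono fun ω hω => ?_) ((hP.measure_eq hmeas).trans_le
    (ADSampling.haarOrthogonal_exists_headCone_le hD hx hε))
  obtain ⟨d, hd0, hdD, hrej⟩ := ADSampling.exists_rejects_of_failure hD ε₀ step (P ω) o q r h hω
  refine Set.mem_biUnion (Finset.mem_Ioo.2 ⟨hd0, hdD⟩)
    (ADSampling.mem_headCone_of_rejects hε hd0 hD ?_ hrej)
  rwa [ADSampling.norm_transform, ← dist_eq_norm]
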